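/- Let $\mathbb F$ be a finite field and let $\mathbb V=V^\diamond\oplus V$, where $V^\diamond=\prod_{j\le 0}\mathbb F$ is compact with the product topology and $V=\bigoplus_{j\ge 1}\mathbb F$ is discrete. Thus $\mathbb V$ is the locally compact space of two-sided sequences $(v_j)_{j\in\mathbb Z}$ in $\mathbb F$ with $v_j=0$ for sufficiently large $j$. Let $\overline{\mathrm{GL}}$ be the group of all invertible linear transformations of $\mathbb V$ that are continuous together with their inverses and preserve the Haar measure on $\mathbb V$, with the topology of uniform convergence on compact subsets of $\mathbb V$. For $k\in\mathbb Z$ put $W_k=\{v\in\mathbb V: v_j=0 \text{ for all } j>k\}$, and for integers $l\le k$ let $\overline Q_{l,k}\subset\overline{\mathrm{GL}}$ be the subgroup of all $g$ such that $gW_k=W_k$, $gW_l=W_l$ and $g$ induces the identity on $W_k/W_l$. In particular, $\overline Q_{0,0}=\{g: gW_0=W_0\}$. Corollary. The subgroup $\overline Q_{0,0}$ is spherical in $\overline{\mathrm{GL}}$. That is, for every irreducible (strongly continuous) unitary representation of $\overline{\mathrm{GL}}$ in a separable complex Hilbert space, the subspace of $\overline Q_{0,0}$-fixed vectors has dimension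 at most $1$; moreover, there exists a unitary representation of $\overline{\mathrm{GL}}$ in a separable Hilbert space that has a nonzero $\overline Q_{0,0}$-fixed vector. -/

import Mathlib

open MeasureTheory

universe u v

noncomputable section

namespace NeretinGL

/-! ## The locally compact space of two-sided sequences -/

/-- The direct product `V^⋄` of countably many copies of `F`. The `n`-th entry
(`n = 0, 1, 2, …`) is the coordinate with index `-n` of a two-sided sequence. -/
def Vdual (F : Type u) : Type u := ℕ → F

/-- The direct sum `V` of countably many copies of `F`. The `n`-th entry (`n = 0, 1, 2, …`)
is the coordinate with index `n + 1` of a two-sided sequence. -/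
def Vfin (F : Type u) [Zero F] : Type u := ℕ →₀ F

section Instances

variable (F : Type u) [Field F]

instance : AddCommGroup (Vdual F) := inferInstanceAs (AddCommGroup (ℕ → F))
instance : Module F (Vdual F) := inferInstanceAs (Module F (ℕ → F))
instance : AddCommGroup (Vfin F) := inferInstanceAs (AddCommGroup (ℕ →₀ F))
instance : Module F (Vfin F) := inferInstanceAs (Module F (ℕ →₀ F))

/-- The product topology of the discrete topologies on the factors. -/
instance : TopologicalSpace (Vdual F) :=
  @Pi.topologicalSpace ℕ (fun _ => F) (fun _ => ⊥)

/-- The discrete topology. -/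
instance : TopologicalSpace (Vfin F) := ⊥

instance : DiscreteTopology (Vfin F) := ⟨rfl⟩

instance : IsTopologicalAddGroup (Vdual F) := by
  let _ : TopologicalSpace F := ⊥
  have : DiscreteTopology F := ⟨rfl⟩
  exact inferInstanceAs (IsTopologicalAddGroup (ℕ → F))

instance [Finite F] : CompactSpace (Vdual F) := by
  let _ : TopologicalSpace F := ⊥
  have : DiscreteTopology F := ⟨rfl⟩
  exact inferInstanceAs (CompactSpace (ℕ → F))

end Instances

/-- The space `𝕍 = V^⋄ ⊕ V` with the product topology. -/
abbrev VV (F : Type u) [Field F] : Type u := Vdual F × Vfin F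

section Space

variable {F : Type u} [Field F]

/-- The entries `v_j`, `j ∈ ℤ`, of an element of `𝕍`, regarded as a two-sided sequence
`(…, v_{-1}, v_0, v_1, …)`. -/
def coord (v : VV F) (j : ℤ) : F :=
  if j ≤ 0 then (show ℕ → F from v.1) (-j).toNat else (show ℕ →₀ F from v.2) (j - 1).toNat

theorem coord_add (v w : VV F) (j : ℤ) : coord (v + w) j = coord v j + coord w j := by
  unfold coord; split_ifs <;> rfl

theorem coord_smul (c : F) (v : VV F) (j : ℤ) : coord (c • v) j = c * coord v j := by
  unfold coord; split_ifs <;> rfl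

theorem coord_zero (j : ℤ) : coord (0 : VV F) j = 0 := by
  unfold coord; split_ifs <;> rfl

variable (F) in
/-- The subspace `W_k` of all two-sided sequences such that `v_j = 0` for `j > k`. -/
def W (k : ℤ) : Submodule F (VV F) where
  carrier := {v | ∀ j : ℤ, k < j → coord v j = 0}
  add_mem' := fun {v w} hv hw j hj => by rw [coord_add, hv j hj, hw j hj, add_zero]
  zero_mem' := fun j _ => coord_zero j
  smul_mem' := fun c v hv j hj => by rw [coord_smul, hv j hj, mul_zero]

theorem mem_W_zero_iff (v : VV F) : v ∈ W F 0 ↔ v.2 = 0 := by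
  constructor
  · intro h
    refine Finsupp.ext (fun n => ?_)
    have := h (n + 1) (by omega)
    have hn : ¬ ((n : ℤ) + 1 ≤ 0) := by omega
    simp only [coord, hn, if_false, add_sub_cancel_right, Int.toNat_natCast] at this
    exact this
  · intro h j hj
    have hn : ¬ (j ≤ 0) := by omega
    simp only [coord, hn, if_false, h]
    rfl

theorem W_zero_eq : (W F 0 : Set (VV F)) = Set.univ ×ˢ {0} := by
  ext v
  simp [mem_W_zero_iff]

variable (F) in
/-- The compact open subspace `V^⋄ = W_0` of `𝕍`. -/
def W0Compacts [Finite F] : TopologicalSpace.PositiveCompacts (VV F) where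
  carrier := (W F 0 : Set (VV F))
  isCompact' := by
    rw [W_zero_eq]
    exact isCompact_univ.prod isCompact_singleton
  interior_nonempty' := by
    have : IsOpen (W F 0 : Set (VV F)) := by
      rw [W_zero_eq]
      exact isOpen_univ.prod (isOpen_discrete _)
    refine ⟨0, ?_⟩
    rw [this.interior_eq]
    exact (W F 0).zero_mem

end Space

/-! ## The group of measure preserving continuous linear transformations -/

section Group

variable (F : Type u) [Field F]

/-- The Borel `σ`-algebra of `𝕍`. -/
instance : MeasurableSpace (VV F) := borel (VV F)

instance : BorelSpace (VV F) := ⟨rfl⟩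

/-- The Haar measure on `𝕍` normalized so that `V^⋄` has measure `1`. -/
def haarVV [Finite F] : Measure (VV F) := Measure.addHaarMeasure (W0Compacts F)

/-- The group of all invertible linear transformations of `𝕍`, continuous together with their
inverses, that preserve the Haar measure on `𝕍`. -/
def GLL [Finite F] : Subgroup (VV F ≃L[F] VV F) where
  carrier := {g | MeasurePreserving g (haarVV F) (haarVV F)}
  one_mem' := MeasurePreserving.id (haarVV F)
  mul_mem' := fun {g h} (hg : MeasurePreserving g _ _) (hh : MeasurePreserving h _ _) =>
    hg.comp hh
  inv_mem' := fun {g} hg => MeasurePreserving.symm g.toHomeomorph.toMeasurableEquiv hg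

/-- The topology of uniform convergence on compact subsets of `𝕍`
(that is, the compact-open topology). -/
instance [Finite F] : TopologicalSpace (GLL F) :=
  TopologicalSpace.induced
    (fun g : GLL F => (⟨fun x => g.1 x, g.1.continuous⟩ : C(VV F, VV F))) inferInstance

variable {F}

theorem map_eq_mul {g h : VV F ≃L[F] VV F} {S : Submodule F (VV F)}
    (hg : S.map (g : VV F →ₗ[F] VV F) = S) (hh : S.map (h : VV F →ₗ[F] VV F) = S) :
    S.map ((g * h : VV F ≃L[F] VV F) : VV F →ₗ[F] VV F) = S := by
  have : ((g * h : VV F ≃L[F] VV F) : VV F →ₗ[F] VV F) =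
      (g : VV F →ₗ[F] VV F) ∘ₗ (h : VV F →ₗ[F] VV F) := rfl
  rw [this, Submodule.map_comp, hh, hg]

theorem map_eq_inv {g : VV F ≃L[F] VV F} {S : Submodule F (VV F)}
    (hg : S.map (g : VV F →ₗ[F] VV F) = S) :
    S.map ((g⁻¹ : VV F ≃L[F] VV F) : VV F →ₗ[F] VV F) = S := by
  have : ((g⁻¹ : VV F ≃L[F] VV F) : VV F →ₗ[F] VV F) ∘ₗ (g : VV F →ₗ[F] VV F) =
      LinearMap.id := LinearMap.ext (fun x => g.symm_apply_apply x)
  conv_lhs => rw [← hg]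
  rw [← Submodule.map_comp, this, Submodule.map_id]

variable (F) in
/-- The subgroup `Q̄_{l,k}` (for `l ≤ k`) of all `g` such that `g W_k = W_k`, `g W_l = W_l`, and
`g` induces the identity operator on `W_k / W_l`. -/
def Qbar [Finite F] (l k : ℤ) : Subgroup (GLL F) where
  carrier := {g | (W F k).map (g.1 : VV F →ₗ[F] VV F) = W F k ∧
    (W F l).map (g.1 : VV F →ₗ[F] VV F) = W F l ∧ ∀ v ∈ W F k, g.1 v - v ∈ W F l}
  one_mem' := ⟨Submodule.map_id _, Submodule.map_id _, fun v _ => by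
    have : ((1 : GLL F).1 v) = v := rfl
    rw [this, sub_self]; exact (W F l).zero_mem⟩
  mul_mem' := fun {g h} hg hh => ⟨map_eq_mul hg.1 hh.1, map_eq_mul hg.2.1 hh.2.1, fun v hv => by
    have hv' : h.1 v ∈ W F k := by
      have := Submodule.mem_map_of_mem (f := (h.1 : VV F →ₗ[F] VV F)) hv
      rwa [hh.1] at this
    have e : (g * h).1 v - v = (g.1 (h.1 v) - h.1 v) + (h.1 v - v) :=
      (sub_add_sub_cancel _ _ _).symm
    rw [e]
    exact (W F l).add_mem (hg.2.2 _ hv') (hh.2.2 _ hv)⟩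
  inv_mem' := fun {g} hg => ⟨map_eq_inv hg.1, map_eq_inv hg.2.1, fun v hv => by
    have hv' : g.1.symm v ∈ W F k := by
      have := Submodule.mem_map_of_mem (f := ((g.1⁻¹ : VV F ≃L[F] VV F) : VV F →ₗ[F] VV F)) hv
      rwa [map_eq_inv hg.1] at this
    have h1 := hg.2.2 _ hv'
    rw [g.1.apply_symm_apply] at h1
    have h2 := (W F l).neg_mem h1
    rw [neg_sub] at h2
    exact h2⟩

end Group

/-! ## Unitary representations and spherical subgroups -/

/-- A (strongly continuous) unitary representation of `G` in the Hilbert space `H`. -/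
structure UnitaryRep (G : Type u) [Group G] [TopologicalSpace G] (H : Type v)
    [NormedAddCommGroup H] [InnerProductSpace ℂ H] [CompleteSpace H] where
  /-- The homomorphism to the unitary group. -/
  toHom : G →* unitary (H →L[ℂ] H)
  continuous_apply : ∀ x : H, Continuous fun g : G => (toHom g : H →L[ℂ] H) x

namespace UnitaryRep

variable {G : Type u} [Group G] [TopologicalSpace G] {H : Type v}
  [NormedAddCommGroup H] [InnerProductSpace ℂ H] [CompleteSpace H]

/-- The operator `ρ(g)`. -/
def op (ρ : UnitaryRep G H) (g : G) : H →L[ℂ] H := (ρ.toHom g : H →L[ℂ] H)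

/-- A representation is irreducible if `H ≠ 0` and there are no closed invariant subspaces
except `0` and `H`. -/
def IsIrreducible (ρ : UnitaryRep G H) : Prop :=
  Nontrivial H ∧ ∀ S : Submodule ℂ H, IsClosed (S : Set H) →
    (∀ g : G, ∀ x ∈ S, ρ.op g x ∈ S) → S = ⊥ ∨ S = ⊤

/-- The subspace of vectors fixed by the subgroup `K`. -/
def fixedVectors (ρ : UnitaryRep G H) (K : Subgroup G) : Submodule ℂ H where
  carrier := {x | ∀ g ∈ K, ρ.op g x = x}
  add_mem' := fun hx hy g hg => by rw [map_add, hx g hg, hy g hg]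
  zero_mem' := fun _ _ => map_zero _
  smul_mem' := fun c _ hx g hg => by rw [map_smul, hx g hg]

end UnitaryRep

/-- A subgroup `K` of a topological group `G` is spherical if in each irreducible unitary
representation of `G` in a (separable) Hilbert space the subspace of `K`-fixed vectors has
dimension at most `1`, and some unitary representation of `G` has a nonzero `K`-fixed vector. -/
def IsSpherical {G : Type u} [Group G] [TopologicalSpace G] (K : Subgroup G) : Prop :=
  (∀ (H : Type v) [NormedAddCommGroup H] [InnerProductSpace ℂ H] [CompleteSpace H]
      [TopologicalSpace.SeparableSpace H] (ρ : UnitaryRep G H),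
      ρ.IsIrreducible → Module.rank ℂ (ρ.fixedVectors K) ≤ 1) ∧
  ∃ (H : Type v) (_ : NormedAddCommGroup H) (_ : InnerProductSpace ℂ H) (_ : CompleteSpace H)
    (_ : TopologicalSpace.SeparableSpace H) (ρ : UnitaryRep G H), ρ.fixedVectors K ≠ ⊥

end NeretinGL

end

noncomputable section

open scoped InnerProductSpace

namespace NeretinGL

/-! ## Irreducible commuting families of self-adjoint operators -/

section Schur

variable {M : Type v} [NormedAddCommGroup M] [InnerProductSpace ℂ M] [CompleteSpace M]

/-! This is Gelfand's trick for `K = Qbar F 0 0`, the stabilizer of `W_0`. Let `P` be the orthogonal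
projection onto the `K`-fixed vectors and `T_g = P ρ(g) P` the compressed operators. If `g⁻¹ ∈ KgK`
for every `g`, then `T_g* = T_{g⁻¹} = T_g`. Since `P` is a limit of averages of `ρ(k)`, the products
`T_g T_h` are limits of averages of the self-adjoint `T_{gkh}`, hence self-adjoint, so the `T_g`
commute. Irreducibility of `ρ` passes to the family `T_g`, and a commuting self-adjoint family
without common closed invariant subspaces lives in dimension at most one
(`rank_fixedVectors_le_one`). No compactness of `K` is used: Haar averaging is replaced by the
Alaoglu–Birkhoff theorem (`proj_mem_closure_averages`).

The double coset condition (`exists_inv_eq_mul_mul`) is linear algebra. `W_0` and `gW_0` are compact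
open of equal measure, so `W_0 ∩ gW_0` has the same finite index in both, and some involution `s` in
the group interchanges them. Then `sg` and `g⁻¹s` lie in `K`, which gives `g⁻¹ = (sg)⁻¹ g (g⁻¹s)`.

For existence, the indicator of `W_0` is a nonzero `K`-fixed vector in `L²(𝕍)`. -/

/-- A self-adjoint operator which has no closed invariant subspaces in common with the operators
commuting with it is a scalar. -/
theorem exists_eq_smul_one_of_irreducible {S : Set (M →L[ℂ] M)} {T : M →L[ℂ] M}
    (hT : IsSelfAdjoint T) (hcomm : ∀ R ∈ S, Commute T R)
    (hirr : ∀ N : Submodule ℂ M, IsClosed (N : Set M) → (∀ R ∈ S, ∀ x ∈ N, R x ∈ N) →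
      N = ⊥ ∨ N = ⊤) :
    ∃ c : ℝ, T = algebraMap ℝ (M →L[ℂ] M) c := by
  -- The kernel of `cfc f T` is closed and invariant under `S`, because `cfc f T` commutes with
  -- whatever `T` commutes with. It contains the range of `cfc g T`.
  have key : ∀ f g : ℝ → ℝ, Continuous f → Continuous g → (∀ t, f t * g t = 0) →
      cfc f T = 0 ∨ cfc g T = 0 := by
    intro f g hf hg hfg
    have hmul : cfc f T * cfc g T = 0 := by
      rw [← cfc_mul f g T hf.continuousOn hg.continuousOn]
      simp [hfg]
    rcases hirr (cfc f T).ker (cfc f T).isClosed_ker (fun R hR x hx => by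
      have hc : Commute (cfc f T) R := hT.commute_cfc (hcomm R hR) f
      have : (cfc f T) (R x) = R ((cfc f T) x) := congrArg (fun A : M →L[ℂ] M => A x) hc.eq
      rw [LinearMap.mem_ker] at hx ⊢
      erw [this, hx, map_zero]) with h | h
    · right
      ext x
      have : (cfc g T) x ∈ (cfc f T).ker := congrArg (fun A : M →L[ℂ] M => A x) hmul
      rw [h] at this
      simpa using this
    · left
      ext x
      have : x ∈ (cfc f T).ker := h ▸ Submodule.mem_top
      exact this
  have hsub : (spectrum ℝ T).Subsingleton := by
    by_contra hns
    rw [Set.not_subsingleton_iff] at hns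
    obtain ⟨a, ha, b, hb, hab⟩ := hns.exists_lt
    have hne : ∀ f : ℝ → ℝ, Continuous f → ∀ t ∈ spectrum ℝ T, f t ≠ 0 → cfc f T ≠ 0 := by
      intro f hf t ht hft h0
      have hmem : f t ∈ spectrum ℝ (cfc f T) := by
        rw [cfc_map_spectrum f T hT hf.continuousOn]
        exact ⟨t, ht, rfl⟩
      have : Nontrivial (M →L[ℂ] M) := by
        by_contra hn
        rw [not_nontrivial_iff_subsingleton] at hn
        rw [spectrum.of_subsingleton] at ht
        exact ht
      rw [h0, spectrum.zero_eq] at hmem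
      exact hft hmem
    -- Two spectral points `a < b` are separated by functions supported on either side of their
    -- midpoint. Their product is zero, but neither vanishes on the spectrum.
    rcases key (fun t => max (t - (a + b) / 2) 0) (fun t => max ((a + b) / 2 - t) 0)
        (by fun_prop) (by fun_prop) (fun t => by
          rcases le_total t ((a + b) / 2) with h | h
          · rw [max_eq_right (by linarith), zero_mul]
          · rw [max_eq_right (a := _ - t) (by linarith), mul_zero]) with h | h
    · exact hne _ (by fun_prop) b hb (by
        have : 0 < b - (a + b) / 2 := by linarith
        simp only [max_eq_left this.le]; exact this.ne') h
    · exact hne _ (by fun_prop) a ha (by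
        have : 0 < (a + b) / 2 - a := by linarith
        simp only [max_eq_left this.le]; exact this.ne') h
  rcases hsub.eq_empty_or_singleton with h | ⟨c, h⟩
  · exact ⟨0, CFC.eq_algebraMap_of_spectrum_subset_singleton T 0 (by simp [h])⟩
  · exact ⟨c, CFC.eq_algebraMap_of_spectrum_subset_singleton T c h.subset⟩

/-- Every member of `S` commutes with all of `S`, hence is a scalar. Then every line is invariant,
and irreducibility makes any line the whole space. -/
theorem rank_le_one_of_irreducible {S : Set (M →L[ℂ] M)} (hsa : ∀ T ∈ S, IsSelfAdjoint T)
    (hcomm : ∀ T ∈ S, ∀ R ∈ S, Commute T R)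
    (hirr : ∀ N : Submodule ℂ M, IsClosed (N : Set M) → (∀ R ∈ S, ∀ x ∈ N, R x ∈ N) →
      N = ⊥ ∨ N = ⊤) :
    Module.rank ℂ M ≤ 1 := by
  rcases subsingleton_or_nontrivial M with h | h
  · rw [rank_subsingleton']; exact zero_le_one
  obtain ⟨x, hx⟩ := exists_ne (0 : M)
  rcases hirr (ℂ ∙ x) (Submodule.closed_of_finiteDimensional _) (fun R hR y hy => by
    obtain ⟨c, hc⟩ := exists_eq_smul_one_of_irreducible (hsa R hR) (hcomm R hR) hirr
    rw [hc, Algebra.algebraMap_eq_smul_one]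
    have : ((c • (1 : M →L[ℂ] M)) y) = (c : ℂ) • y := rfl
    rw [this]
    exact Submodule.smul_mem _ _ hy) with h | h
  · exact absurd (Submodule.span_singleton_eq_bot.1 h) hx
  · rw [← rank_top, ← h]
    exact (rank_span_le _).trans (by simp)

end Schur

/-! ## Averaging over a subgroup -/

/-- A nonempty closed convex set has a vector which is the only one of its norm, namely the vector
of minimal norm. -/
theorem exists_mem_forall_norm_eq {E : Type v} [NormedAddCommGroup E] [InnerProductSpace ℝ E]
    [CompleteSpace E] {D : Set E} (hne : D.Nonempty) (hcl : IsClosed D) (hconv : Convex ℝ D) :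
    ∃ y ∈ D, ∀ z ∈ D, ‖z‖ = ‖y‖ → z = y := by
  obtain ⟨y, hyD, hy⟩ := exists_norm_eq_iInf_of_complete_convex hne hcl.isComplete hconv 0
  rw [norm_eq_iInf_iff_real_inner_le_zero hconv hyD] at hy
  refine ⟨y, hyD, fun z hz hzy => ?_⟩
  have h1 := hy z hz
  rw [zero_sub, inner_neg_left, inner_sub_right, real_inner_self_eq_norm_sq] at h1
  have h3 := norm_sub_sq_real z y
  rw [hzy, real_inner_comm] at h3
  have h4 : ‖z - y‖ ^ 2 ≤ 0 := by linarith
  exact sub_eq_zero.1 (norm_eq_zero.1 (pow_eq_zero_iff two_ne_zero |>.1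
    (h4.antisymm (sq_nonneg _))))

namespace UnitaryRep

variable {G : Type u} [Group G] [TopologicalSpace G] {H : Type v}
  [NormedAddCommGroup H] [InnerProductSpace ℂ H] [CompleteSpace H] (ρ : UnitaryRep G H)
  (K : Subgroup G)

theorem op_mul (g h : G) : ρ.op (g * h) = ρ.op g * ρ.op h := by
  simp [op]

theorem op_one : ρ.op 1 = 1 := by
  simp [op]

theorem op_mul_apply (g h : G) (x : H) : ρ.op (g * h) x = ρ.op g (ρ.op h x) := by
  rw [op_mul]; rfl

theorem norm_op_apply (g : G) (x : H) : ‖ρ.op g x‖ = ‖x‖ :=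
  Unitary.norm_map (ρ.toHom g) x

theorem inner_op_op (g : G) (x y : H) : ⟪ρ.op g x, ρ.op g y⟫_ℂ = ⟪x, y⟫_ℂ :=
  Unitary.inner_map_map (ρ.toHom g) x y

theorem inner_op_left (g : G) (x y : H) : ⟪ρ.op g x, y⟫_ℂ = ⟪x, ρ.op g⁻¹ y⟫_ℂ := by
  rw [← ρ.inner_op_op g x, ← op_mul_apply, mul_inv_cancel, op_one]; rfl

theorem isClosed_fixedVectors : IsClosed (ρ.fixedVectors K : Set H) := by
  have : (ρ.fixedVectors K : Set H) = ⋂ g ∈ K, {x | ρ.op g x = x} := by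
    ext x; simp [fixedVectors]
  rw [this]
  exact isClosed_biInter fun g _ => isClosed_eq (ρ.op g).continuous continuous_id

instance : CompleteSpace (ρ.fixedVectors K) :=
  (ρ.isClosed_fixedVectors K).completeSpace_coe

/-- The orthogonal projection onto the subspace of `K`-fixed vectors. -/
def proj : H →L[ℂ] H := (ρ.fixedVectors K).starProjection

theorem proj_mem (x : H) : ρ.proj K x ∈ ρ.fixedVectors K :=
  Submodule.starProjection_apply_mem _ x

theorem proj_eq_self {x : H} (hx : x ∈ ρ.fixedVectors K) : ρ.proj K x = x :=
  Submodule.starProjection_eq_self_iff.2 hx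

theorem inner_proj_left {y : H} (hy : y ∈ ρ.fixedVectors K) (x : H) :
    ⟪ρ.proj K x, y⟫_ℂ = ⟪x, y⟫_ℂ := by
  rw [proj, Submodule.inner_starProjection_left_eq_right, Submodule.starProjection_eq_self_iff.2 hy]

theorem inner_proj_right {x : H} (hx : x ∈ ρ.fixedVectors K) (y : H) :
    ⟪x, ρ.proj K y⟫_ℂ = ⟪x, y⟫_ℂ := by
  rw [proj, ← Submodule.inner_starProjection_left_eq_right,
    Submodule.starProjection_eq_self_iff.2 hx]

/-- Fixed vectors `w` satisfy `⟪ρ(k)x, w⟫ = ⟪x, ρ(k⁻¹)w⟫ = ⟪x, w⟫`, so `x` and `ρ(k)x` differ by a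
vector orthogonal to them. -/
theorem proj_op {k : G} (hk : k ∈ K) (x : H) : ρ.proj K (ρ.op k x) = ρ.proj K x := by
  refine Submodule.eq_starProjection_of_mem_of_inner_eq_zero (ρ.proj_mem K _) fun w hw => ?_
  rw [inner_sub_left, inner_proj_left _ _ hw, inner_op_left, hw _ (K.inv_mem hk), sub_self]

/-- The set of averages of the operators `ρ(k)`, `k ∈ K`. -/
def averages : Set (H →L[ℂ] H) := convexHull ℝ (ρ.op '' K)

variable {K}

theorem op_mem_averages {k : G} (hk : k ∈ K) : ρ.op k ∈ ρ.averages K :=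
  subset_convexHull ℝ _ ⟨k, hk, rfl⟩

theorem averages_induction {p : (H →L[ℂ] H) → Prop} (hp : Convex ℝ {c | p c})
    (h : ∀ k ∈ K, p (ρ.op k)) {c : H →L[ℂ] H} (hc : c ∈ ρ.averages K) : p c :=
  convexHull_min (by rintro _ ⟨k, hk, rfl⟩; exact h k hk) hp hc

theorem mul_mem_averages {c d : H →L[ℂ] H} (hc : c ∈ ρ.averages K) (hd : d ∈ ρ.averages K) :
    c * d ∈ ρ.averages K := by
  refine ρ.averages_induction (p := fun c => c * d ∈ ρ.averages K)
    ((convex_convexHull ℝ _).linear_preimage (LinearMap.mulRight ℝ d)) (fun k hk => ?_) hc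
  refine ρ.averages_induction (p := fun d => ρ.op k * d ∈ ρ.averages K)
    ((convex_convexHull ℝ _).linear_preimage (LinearMap.mulLeft ℝ (ρ.op k))) (fun l hl => ?_) hd
  rw [← op_mul]
  exact ρ.op_mem_averages (K.mul_mem hk hl)

theorem proj_average {c : H →L[ℂ] H} (hc : c ∈ ρ.averages K) (x : H) :
    ρ.proj K (c x) = ρ.proj K x := by
  refine ρ.averages_induction (p := fun c => ρ.proj K (c x) = ρ.proj K x) ?_
    (fun k hk => ρ.proj_op K hk x) hc
  intro c hc d hd a b _ _ hab
  simp only [Set.mem_ofPred_eq] at hc hd ⊢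
  have : (a • c + b • d) x = (a : ℂ) • c x + (b : ℂ) • d x := rfl
  rw [this, map_add, map_smul, map_smul, hc, hd, ← add_smul, ← Complex.ofReal_add, hab]
  simp

theorem norm_average_apply_le {c : H →L[ℂ] H} (hc : c ∈ ρ.averages K) (x : H) :
    ‖c x‖ ≤ ‖x‖ := by
  refine ρ.averages_induction (p := fun c => ‖c x‖ ≤ ‖x‖) ?_
    (fun k _ => (ρ.norm_op_apply k x).le) hc
  have : {c : H →L[ℂ] H | ‖c x‖ ≤ ‖x‖} =
      ((ContinuousLinearMap.apply ℂ H x : (H →L[ℂ] H) →L[ℂ] H).restrictScalars ℝ :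
        (H →L[ℂ] H) →ₗ[ℝ] H) ⁻¹' Metric.closedBall 0 ‖x‖ := by
    ext c; simp
  rw [this]
  exact (convex_closedBall _ _).linear_preimage _

theorem average_apply_fixed {c : H →L[ℂ] H} (hc : c ∈ ρ.averages K) {x : H}
    (hx : x ∈ ρ.fixedVectors K) : c x = x := by
  refine ρ.averages_induction (p := fun c => c x = x) ?_ (fun k hk => hx k hk) hc
  intro c hc d hd a b _ _ hab
  simp only [Set.mem_ofPred_eq] at hc hd ⊢
  have : (a • c + b • d) x = (a : ℂ) • c x + (b : ℂ) • d x := rfl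
  rw [this, hc, hd, ← add_smul, ← Complex.ofReal_add, hab]
  simp

/-- The Alaoglu–Birkhoff theorem: the projection of `x` to the fixed vectors is a limit of
averages of the orbit of `x`. -/
theorem proj_mem_closure_averages (x : H) :
    ρ.proj K x ∈ closure ((fun c : H →L[ℂ] H => c x) '' ρ.averages K) := by
  set D := closure ((fun c : H →L[ℂ] H => c x) '' ρ.averages K) with hD
  have hconv : Convex ℝ D := by
    refine Convex.closure ?_
    rintro _ ⟨c, hc, rfl⟩ _ ⟨d, hd, rfl⟩ a b ha hb hab
    exact ⟨a • c + b • d, convex_convexHull ℝ _ hc hd ha hb hab, rfl⟩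
  have hne : D.Nonempty :=
    ⟨ρ.op 1 x, subset_closure ⟨_, ρ.op_mem_averages K.one_mem, rfl⟩⟩
  obtain ⟨y, hyD, hy⟩ := @exists_mem_forall_norm_eq H _ (InnerProductSpace.rclikeToReal ℂ H) _ D
    hne isClosed_closure hconv
  have hinv : ∀ k ∈ K, ∀ z ∈ D, ρ.op k z ∈ D := by
    intro k hk z hz
    refine map_mem_closure (ρ.op k).continuous hz ?_
    rintro _ ⟨c, hc, rfl⟩
    exact ⟨ρ.op k * c, ρ.mul_mem_averages (ρ.op_mem_averages hk) hc, rfl⟩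
  -- `ρ(k)` maps `D` to itself and preserves norms, so uniqueness of the vector of minimal norm
  -- forces `ρ(k)y = y`.
  have hfix : y ∈ ρ.fixedVectors K := fun k hk => hy _ (hinv k hk y hyD) (ρ.norm_op_apply k y)
  have hconst : ∀ z ∈ D, ρ.proj K z = ρ.proj K x := by
    intro z hz
    refine closure_minimal (t := {z | ρ.proj K z = ρ.proj K x}) ?_
      (isClosed_eq (ρ.proj K).continuous continuous_const) hz
    rintro _ ⟨c, hc, rfl⟩
    exact ρ.proj_average hc x
  rw [← hconst y hyD, ρ.proj_eq_self K hfix]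
  exact hyD

/-- One average serves both vectors. Choose `c` for `x`, then `d` for `c y`: applying `d` does not
spoil the first estimate, since `d` is a contraction fixing `ρ.proj K x`. -/
theorem exists_average_norm_sub_lt (x y : H) {ε : ℝ} (hε : 0 < ε) :
    ∃ c ∈ ρ.averages K, ‖c x - ρ.proj K x‖ < ε ∧ ‖c y - ρ.proj K y‖ < ε := by
  obtain ⟨_, ⟨c, hc, rfl⟩, hcx⟩ := Metric.mem_closure_iff.1 (ρ.proj_mem_closure_averages (K := K) x)
    ε hε
  obtain ⟨_, ⟨d, hd, rfl⟩, hdy⟩ := Metric.mem_closure_iff.1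
    (ρ.proj_mem_closure_averages (K := K) (c y)) ε hε
  rw [dist_comm, dist_eq_norm] at hcx hdy
  refine ⟨d * c, ρ.mul_mem_averages hd hc, ?_, ?_⟩
  · have : (d * c) x - ρ.proj K x = d (c x - ρ.proj K x) := by
      rw [map_sub, ρ.average_apply_fixed hd (ρ.proj_mem K x)]; rfl
    rw [this]
    exact (ρ.norm_average_apply_le hd _).trans_lt hcx
  · rw [ρ.proj_average hc] at hdy
    exact hdy

/-! ## The Gelfand trick -/

section Gelfand

/-- Compressions to the fixed vectors are self-adjoint: the adjoint of `ρ(g)` is `ρ(g⁻¹)`, and the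
factors from `K` in `g⁻¹ = kgl` are absorbed by `x` and `y`. -/
theorem inner_op_symm (hK : ∀ g : G, ∃ k ∈ K, ∃ l ∈ K, g⁻¹ = k * g * l) {x y : H}
    (hx : x ∈ ρ.fixedVectors K) (hy : y ∈ ρ.fixedVectors K) (g : G) :
    ⟪ρ.op g x, y⟫_ℂ = ⟪x, ρ.op g y⟫_ℂ := by
  obtain ⟨k, hk, l, hl, h⟩ := hK g
  rw [inner_op_left, h, op_mul_apply, op_mul_apply, hy l hl, ← inv_inv k, ← inner_op_left,
    hx _ (K.inv_mem hk)]

/-- Self-adjointness of a product of two compressions. With `ρ(k)` in place of the projection this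
is `inner_op_symm` for `gkh`. It survives real convex combinations, then the limit. -/
theorem inner_op_proj_op (hK : ∀ g : G, ∃ k ∈ K, ∃ l ∈ K, g⁻¹ = k * g * l) {x y : H}
    (hx : x ∈ ρ.fixedVectors K) (hy : y ∈ ρ.fixedVectors K) (g h : G) :
    ⟪ρ.op g (ρ.proj K (ρ.op h x)), y⟫_ℂ = ⟪x, ρ.op g (ρ.proj K (ρ.op h y))⟫_ℂ := by
  have havg : ∀ c ∈ ρ.averages K,
      ⟪ρ.op g (c (ρ.op h x)), y⟫_ℂ = ⟪x, ρ.op g (c (ρ.op h y))⟫_ℂ := by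
    intro c hc
    refine ρ.averages_induction
      (p := fun c => ⟪ρ.op g (c (ρ.op h x)), y⟫_ℂ = ⟪x, ρ.op g (c (ρ.op h y))⟫_ℂ)
      ?_ (fun k _ => ?_) hc
    · intro c hc d hd a b _ _ _
      simp only [Set.mem_ofPred_eq] at hc hd ⊢
      have : ∀ z, (a • c + b • d) z = (a : ℂ) • c z + (b : ℂ) • d z := fun _ => rfl
      simp only [this, map_add, map_smul, inner_add_left, inner_add_right, inner_smul_left,
        inner_smul_right, hc, hd, Complex.conj_ofReal]
    · rw [← op_mul_apply, ← op_mul_apply, ← op_mul_apply, ← op_mul_apply]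
      exact ρ.inner_op_symm hK hx hy _
  refine eq_of_forall_dist_le fun ε hε => ?_
  have hδ : 0 < ε / (‖x‖ + ‖y‖ + 1) := by positivity
  obtain ⟨c, hc, h1, h2⟩ := ρ.exists_average_norm_sub_lt (K := K) (ρ.op h x) (ρ.op h y) hδ
  have e : ⟪ρ.op g (ρ.proj K (ρ.op h x)), y⟫_ℂ - ⟪x, ρ.op g (ρ.proj K (ρ.op h y))⟫_ℂ =
      ⟪x, ρ.op g (c (ρ.op h y) - ρ.proj K (ρ.op h y))⟫_ℂ -
        ⟪ρ.op g (c (ρ.op h x) - ρ.proj K (ρ.op h x)), y⟫_ℂ := by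
    rw [map_sub, map_sub, inner_sub_left, inner_sub_right, havg c hc]; ring
  rw [dist_eq_norm, e]
  refine (norm_sub_le _ _).trans ?_
  have b1 := norm_inner_le_norm (𝕜 := ℂ) x (ρ.op g (c (ρ.op h y) - ρ.proj K (ρ.op h y)))
  have b2 := norm_inner_le_norm (𝕜 := ℂ) (ρ.op g (c (ρ.op h x) - ρ.proj K (ρ.op h x))) y
  rw [norm_op_apply] at b1 b2
  have b3 := mul_le_mul_of_nonneg_left h2.le (norm_nonneg x)
  have b4 := mul_le_mul_of_nonneg_right h1.le (norm_nonneg y)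
  have b5 : (‖x‖ + ‖y‖ + 1) * (ε / (‖x‖ + ‖y‖ + 1)) = ε := mul_div_cancel₀ _ (by positivity)
  nlinarith

/-- If each double coset of `K` is invariant under inversion, then `K` has at most one fixed
vector, up to a factor, in each irreducible representation. -/
theorem rank_fixedVectors_le_one (hK : ∀ g : G, ∃ k ∈ K, ∃ l ∈ K, g⁻¹ = k * g * l)
    (hρ : ρ.IsIrreducible) : Module.rank ℂ (ρ.fixedVectors K) ≤ 1 := by
  let M := ρ.fixedVectors K
  let T : G → M →L[ℂ] M := fun g =>
    ((ρ.proj K ∘L ρ.op g) ∘L M.subtypeL).codRestrict M fun x => ρ.proj_mem K _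
  have hT : ∀ g (x : M), (T g x : H) = ρ.proj K (ρ.op g x) := fun _ _ => rfl
  have hsymm : ∀ g (x y : M), ⟪T g x, y⟫_ℂ = ⟪x, T g y⟫_ℂ := by
    intro g x y
    rw [Submodule.coe_inner, Submodule.coe_inner, hT, hT, inner_proj_left _ _ y.2,
      inner_proj_right _ _ x.2, ρ.inner_op_symm hK x.2 y.2]
  refine rank_le_one_of_irreducible (S := Set.range T) ?_ ?_ ?_
  · rintro _ ⟨g, rfl⟩
    rw [ContinuousLinearMap.isSelfAdjoint_iff_isSymmetric]
    exact hsymm g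
  · rintro _ ⟨g, rfl⟩ _ ⟨h, rfl⟩
    refine ContinuousLinearMap.ext fun x => ext_inner_right ℂ fun y => ?_
    have h1 : ⟪T g (T h x), y⟫_ℂ = ⟪x, T g (T h y)⟫_ℂ := by
      rw [Submodule.coe_inner, Submodule.coe_inner, hT, hT, hT, hT, inner_proj_left _ _ y.2,
        inner_proj_right _ _ x.2, ρ.inner_op_proj_op hK x.2 y.2]
    change ⟪T g (T h x), y⟫_ℂ = ⟪T h (T g x), y⟫_ℂ
    -- Both sides become `⟪x, T g (T h y)⟫`: on the left because the product is self-adjoint, on the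
    -- right because each factor is.
    rw [h1, hsymm, hsymm]
  · intro N hN hinv
    by_cases hbot : N = ⊥
    · exact Or.inl hbot
    right
    obtain ⟨x, hxN, hx⟩ := Submodule.exists_mem_ne_zero_of_ne_bot hbot
    -- The orbit of `x ∈ N` spans a dense subspace by irreducibility of `ρ`, and its projection to
    -- `M` stays in `N` because `N` is invariant under all `T g`.
    set S₀ : Submodule ℂ H := Submodule.span ℂ (Set.range fun g => ρ.op g (x : H)) with hS₀
    have hS₀inv : ∀ g, ∀ y ∈ S₀, ρ.op g y ∈ S₀ := by
      intro g y hy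
      refine Submodule.span_induction (p := fun y _ => ρ.op g y ∈ S₀) ?_ ?_ ?_ ?_ hy
      · rintro _ ⟨h, rfl⟩
        exact Submodule.subset_span ⟨g * h, ρ.op_mul_apply g h x⟩
      · rw [map_zero]; exact S₀.zero_mem
      · intro a b _ _ ha hb; rw [map_add]; exact S₀.add_mem ha hb
      · intro a b _ hb; rw [map_smul]; exact S₀.smul_mem a hb
    have hxS : (x : H) ∈ S₀ := Submodule.subset_span ⟨1, by simp [op_one]⟩
    have htop : S₀.topologicalClosure = ⊤ := by
      rcases hρ.2 S₀.topologicalClosure S₀.isClosed_topologicalClosure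
        (fun g y hy => map_mem_closure (ρ.op g).continuous hy (hS₀inv g)) with h | h
      · have := S₀.le_topologicalClosure hxS
        rw [h, Submodule.mem_bot] at this
        exact absurd (Subtype.ext this) hx
      · exact h
    let P : H →L[ℂ] M := (ρ.proj K).codRestrict M (ρ.proj_mem K)
    have hPN : ∀ y ∈ S₀, P y ∈ N := by
      intro y hy
      refine Submodule.span_induction (p := fun y _ => P y ∈ N) ?_ ?_ ?_ ?_ hy
      · rintro _ ⟨h, rfl⟩
        exact hinv _ ⟨h, rfl⟩ x hxN
      · rw [map_zero]; exact N.zero_mem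
      · intro a b _ _ ha hb; rw [map_add]; exact N.add_mem ha hb
      · intro a b _ hb; rw [map_smul]; exact N.smul_mem a hb
    rw [eq_top_iff]
    rintro y -
    have hy : (y : H) ∈ S₀.topologicalClosure := htop ▸ Submodule.mem_top
    have : P y ∈ closure (N : Set M) := map_mem_closure P.continuous hy hPN
    rw [hN.closure_eq] at this
    have e : P y = y := Subtype.ext (ρ.proj_eq_self K y.2)
    rwa [e] at this

end Gelfand

end UnitaryRep

end NeretinGL

namespace NeretinGL

/-! ## Interchanging commensurable subspaces -/

section Swap

variable {F : Type u} [Field F] {V : Type u} [AddCommGroup V] [Module F V]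

/-- A linear retraction to `A` which vanishes on `B`. -/
theorem exists_retraction {A B : Submodule F V} (h : Disjoint A B) :
    ∃ p : V →ₗ[F] A, (∀ a : A, p a = a) ∧ ∀ b ∈ B, p b = 0 := by
  have hker : (B.mkQ ∘ₗ A.subtype).ker = ⊥ := by
    rw [LinearMap.ker_comp, Submodule.ker_mkQ, ← Submodule.disjoint_iff_comap_eq_bot]
    exact h
  obtain ⟨q, hq⟩ := LinearMap.exists_leftInverse_of_injective _ hker
  refine ⟨q ∘ₗ B.mkQ, fun a => LinearMap.congr_fun hq a, fun b hb => ?_⟩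
  rw [LinearMap.comp_apply, (Submodule.Quotient.mk_eq_zero B).2 hb |> fun h => (h : B.mkQ b = 0),
    map_zero]

/-- If `A ∩ B` has isomorphic complements in `A` and in `B`, then some linear involution
interchanges `A` and `B` and is the identity on `A ∩ B`. -/
theorem exists_swap {A B A' B' : Submodule F V} (hA : A' ⊔ (A ⊓ B) = A) (hB : B' ⊔ (A ⊓ B) = B)
    (hA' : Disjoint A' (A ⊓ B)) (hB' : Disjoint B' (A ⊓ B)) (φ : A' ≃ₗ[F] B') :
    ∃ h : V →ₗ[F] V, Function.Involutive h ∧ (∀ v ∈ A ⊓ B, h v = v) ∧ A.map h = B ∧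
      B.map h = A := by
  have hA'A : A' ≤ A := le_sup_left.trans hA.le
  have hB'B : B' ≤ B := le_sup_left.trans hB.le
  obtain ⟨p, hp, hpB⟩ := exists_retraction (A := A') (B := B) (by
    rw [Submodule.disjoint_def] at hA' ⊢
    exact fun x hx hxB => hA' x hx ⟨hA'A hx, hxB⟩)
  obtain ⟨r, hr, hrA⟩ := exists_retraction (A := B') (B := A) (by
    rw [Submodule.disjoint_def] at hB' ⊢
    exact fun x hx hxA => hB' x hx ⟨hxA, hB'B hx⟩)
  -- Write `v` as `p v + r v` plus a remainder. The map keeps the remainder and exchanges the `A'`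
  -- and `B'` components through `φ`.
  let h : V →ₗ[F] V := LinearMap.id - A'.subtype ∘ₗ p - B'.subtype ∘ₗ r +
    B'.subtype ∘ₗ φ.toLinearMap ∘ₗ p + A'.subtype ∘ₗ φ.symm.toLinearMap ∘ₗ r
  have happ : ∀ v, h v = v - p v - r v + φ (p v) + φ.symm (r v) := fun _ => rfl
  have hpB' : ∀ b : B', p b = 0 := fun b => hpB _ (hB'B b.2)
  have hrA' : ∀ a : A', r a = 0 := fun a => hrA _ (hA'A a.2)
  have hinv : Function.Involutive h := by
    intro v
    have h1 : p (h v) = φ.symm (r v) := by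
      rw [happ]; simp only [map_add, map_sub, hp, hpB']; abel
    have h2 : r (h v) = φ (p v) := by
      rw [happ]; simp only [map_add, map_sub, hr, hrA']; abel
    rw [happ (h v), h1, h2, happ]
    simp only [LinearEquiv.symm_apply_apply, LinearEquiv.apply_symm_apply]
    abel
  have hfix : ∀ v ∈ A ⊓ B, h v = v := by
    intro v hv
    rw [happ, hpB v hv.2, hrA v hv.1]
    simp
  have hAB : A.map h ≤ B := by
    rw [← hA, Submodule.map_sup, sup_le_iff]
    constructor
    · rintro _ ⟨a, ha, rfl⟩
      have := hrA' ⟨a, ha⟩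
      have h2 := hp ⟨a, ha⟩
      simp only at this h2
      rw [happ, this, h2]
      simpa using hB'B (φ ⟨a, ha⟩).2
    · rintro _ ⟨a, ha, rfl⟩
      rw [hfix a ha]; exact ha.2
  have hBA : B.map h ≤ A := by
    rw [← hB, Submodule.map_sup, sup_le_iff]
    constructor
    · rintro _ ⟨a, ha, rfl⟩
      have := hpB' ⟨a, ha⟩
      have h2 := hr ⟨a, ha⟩
      simp only at this h2
      rw [happ, this, h2]
      simpa using hA'A (φ.symm ⟨a, ha⟩).2
    · rintro _ ⟨a, ha, rfl⟩
      rw [hfix a ha]; exact ha.1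
  refine ⟨h, hinv, hfix, hAB.antisymm fun b hb => ?_, hBA.antisymm fun a ha => ?_⟩
  · exact ⟨h b, hBA ⟨b, hb, rfl⟩, hinv b⟩
  · exact ⟨h a, hAB ⟨a, ha, rfl⟩, hinv a⟩

variable [TopologicalSpace V] [IsTopologicalAddGroup V]

/-- `A ∩ D` is open in the compact group `A`, hence of finite index, and `A'` embeds in the
quotient. -/
theorem finite_of_disjoint_of_isOpen {A A' D : Submodule F V} (hA : IsCompact (A : Set V))
    (hD : IsOpen (D : Set V)) (hA' : A' ≤ A) (h : Disjoint A' D) : Finite A' := by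
  have : CompactSpace A.toAddSubgroup := isCompact_iff_compactSpace.1 hA
  have hfin := AddSubgroup.quotient_finite_of_isOpen
    (D.toAddSubgroup.addSubgroupOf A.toAddSubgroup) (hD.preimage continuous_subtype_val)
  refine Finite.of_injective (β := A.toAddSubgroup ⧸ D.toAddSubgroup.addSubgroupOf A.toAddSubgroup)
    (fun a => QuotientAddGroup.mk (⟨a, hA' a.2⟩ : A.toAddSubgroup)) fun a b hab => ?_
  have h1 := QuotientAddGroup.eq.1 hab
  have h2 : -(a : V) + b ∈ D := h1
  have h3 := Submodule.disjoint_def.1 h _ (A'.add_mem (A'.neg_mem a.2) b.2) h2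
  exact Subtype.ext (neg_add_eq_zero.1 h3)

/-- The sum is a disjoint union of translates of `D` indexed by `A'`. -/
theorem measure_sup_eq_card_mul [MeasurableSpace V] [BorelSpace V] (μ : Measure V)
    [μ.IsAddLeftInvariant] {A' D : Submodule F V} [Finite A'] (hD : IsOpen (D : Set V))
    (h : Disjoint A' D) : μ (A' ⊔ D : Submodule F V) = Nat.card A' * μ D := by
  have e : ((A' ⊔ D : Submodule F V) : Set V) = ⋃ a : A', (fun v => -(a : V) + v) ⁻¹' D := by
    ext v
    simp only [SetLike.mem_coe, Submodule.mem_sup, Set.mem_iUnion, Set.mem_preimage]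
    constructor
    · rintro ⟨a, ha, d, hd, rfl⟩
      exact ⟨⟨a, ha⟩, by simpa using hd⟩
    · rintro ⟨a, ha⟩
      exact ⟨a, a.2, _, ha, by simp⟩
  rw [e, measure_iUnion]
  · simp only [measure_preimage_add]
    rw [ENNReal.tsum_const, ENat.card_eq_coe_natCard]
    rfl
  · intro a b hab
    refine Set.disjoint_left.2 fun v hva hvb => hab ?_
    have h1 : -(a : V) + b ∈ D := by
      have h2 := D.sub_mem hva hvb
      simpa only [add_sub_add_right_eq_sub, sub_neg_eq_add] using h2
    exact Subtype.ext (neg_add_eq_zero.1 (Submodule.disjoint_def.1 h _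
      (A'.add_mem (A'.neg_mem a.2) b.2) h1))
  · intro a
    exact (hD.preimage (continuous_const.add continuous_id)).measurableSet

/-- A complement `C` of `A ⊓ B` cuts out complements inside `A` and inside `B`. Equal measure gives
these finite spaces equal cardinality, hence equal dimension over the finite field, so `exists_swap`
applies. The involution is continuous because it is the identity on the open subspace `A ⊓ B`. -/
theorem exists_swap_of_measure_eq [Finite F] [MeasurableSpace V] [BorelSpace V] (μ : Measure V)
    [μ.IsAddHaarMeasure] {A B : Submodule F V} (hA : IsCompact (A : Set V))
    (hB : IsCompact (B : Set V)) (hAo : IsOpen (A : Set V)) (hBo : IsOpen (B : Set V))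
    (hμ : μ A = μ B) :
    ∃ h : V ≃L[F] V, A.map (h : V →ₗ[F] V) = B ∧ B.map (h : V →ₗ[F] V) = A := by
  obtain ⟨C, hC⟩ := exists_isCompl (A ⊓ B)
  have hDo : IsOpen ((A ⊓ B : Submodule F V) : Set V) := hAo.inter hBo
  have hcompl : ∀ {S : Submodule F V}, A ⊓ B ≤ S → (S ⊓ C) ⊔ (A ⊓ B) = S := fun {S} hS => by
    rw [inf_sup_assoc_of_le _ hS, sup_comm, hC.sup_eq_top, inf_top_eq]
  have hdisj : ∀ S : Submodule F V, Disjoint (S ⊓ C) (A ⊓ B) := fun S =>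
    hC.symm.disjoint.mono_left inf_le_right
  have hfA : Finite ↥(A ⊓ C) := finite_of_disjoint_of_isOpen hA hDo inf_le_left (hdisj A)
  have hfB : Finite ↥(B ⊓ C) := finite_of_disjoint_of_isOpen hB hDo inf_le_left (hdisj B)
  have hcard : Nat.card ↥(A ⊓ C) = Nat.card ↥(B ⊓ C) := by
    have h1 := measure_sup_eq_card_mul μ hDo (hdisj A)
    have h2 := measure_sup_eq_card_mul μ hDo (hdisj B)
    rw [hcompl inf_le_left, hμ] at h1
    rw [hcompl inf_le_right, h1] at h2
    have h0 : μ (A ⊓ B : Submodule F V) ≠ 0 := (hDo.measure_pos μ ⟨0, zero_mem _⟩).ne'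
    have ht : μ (A ⊓ B : Submodule F V) ≠ ⊤ :=
      ((measure_mono (fun x hx => hx.1 : ((A ⊓ B : Submodule F V) : Set V) ⊆ A)).trans_lt
        hA.measure_lt_top).ne
    exact_mod_cast (ENNReal.mul_left_inj h0 ht).1 h2
  have hrank : Module.finrank F ↥(A ⊓ C) = Module.finrank F ↥(B ⊓ C) := by
    rw [Module.natCard_eq_pow_finrank (K := F) (V := ↥(A ⊓ C)),
      Module.natCard_eq_pow_finrank (K := F) (V := ↥(B ⊓ C))] at hcard
    exact Nat.pow_right_injective (Finite.one_lt_card (α := F)) hcard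
  obtain ⟨φ⟩ := FiniteDimensional.nonempty_linearEquiv_of_finrank_eq hrank
  obtain ⟨h, hinv, hfix, hAB, hBA⟩ := exists_swap (hcompl inf_le_left) (hcompl inf_le_right)
    (hdisj A) (hdisj B) φ
  have hcont : Continuous h := by
    refine continuous_of_continuousAt_zero h ?_
    have : h =ᶠ[nhds 0] id :=
      Filter.eventually_of_mem (hDo.mem_nhds (zero_mem _)) fun v hv => hfix v hv
    exact continuousAt_id.congr this.symm
  exact ⟨{ LinearEquiv.ofInvolutive h hinv with
    continuous_toFun := hcont
    continuous_invFun := hcont }, hAB, hBA⟩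

end Swap

/-! ## The group `GLL` -/

section Group

variable {F : Type u} [Field F]

instance [Finite F] : SecondCountableTopology (Vdual F) := by
  let _ : TopologicalSpace F := ⊥
  have : DiscreteTopology F := ⟨rfl⟩
  have : Countable F := Finite.to_countable
  exact inferInstanceAs (SecondCountableTopology (ℕ → F))

instance [Finite F] : Countable (Vfin F) := by
  have : Countable F := Finite.to_countable
  exact inferInstanceAs (Countable (ℕ →₀ F))

instance : T2Space (Vdual F) := by
  let _ : TopologicalSpace F := ⊥
  have : DiscreteTopology F := ⟨rfl⟩
  exact inferInstanceAs (T2Space (ℕ → F))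

instance [Finite F] : (haarVV F).IsAddHaarMeasure :=
  inferInstanceAs (Measure.addHaarMeasure (W0Compacts F)).IsAddHaarMeasure

theorem isOpen_W_zero : IsOpen (W F 0 : Set (VV F)) := by
  rw [W_zero_eq]
  exact isOpen_univ.prod (isOpen_discrete _)

variable [Finite F]

theorem haarVV_W_zero : haarVV F (W F 0) = 1 :=
  Measure.addHaarMeasure_self (K₀ := W0Compacts F)

theorem measure_map_eq {g : VV F ≃L[F] VV F} (hg : g ∈ GLL F) (S : Submodule F (VV F)) :
    haarVV F (S.map (g : VV F →ₗ[F] VV F) : Submodule F (VV F)) = haarVV F S := by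
  have hg' : MeasurePreserving g.toHomeomorph.toMeasurableEquiv (haarVV F) (haarVV F) := hg
  rw [← hg'.measure_preimage_equiv]
  congr 1
  exact Set.preimage_image_eq _ g.injective

/-- A continuous linear transformation sending `W_0` to a subspace of measure `1` preserves the
Haar measure. -/
theorem mem_GLL_of_measure_map {g : VV F ≃L[F] VV F}
    (hg : haarVV F ((W F 0).map (g : VV F →ₗ[F] VV F) : Submodule F (VV F)) = 1) : g ∈ GLL F := by
  -- The pushforward under `g⁻¹` is again a Haar measure and gives `W_0` the measure of `gW_0`,
  -- which is `1`. Uniqueness of the normalized Haar measure concludes.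
  have hsymm : MeasurePreserving g.symm (haarVV F) (haarVV F) := by
    refine ⟨g.symm.continuous.measurable, ?_⟩
    have hm : ((haarVV F).map g.symm).IsAddHaarMeasure :=
      g.symm.isAddHaarMeasure_map (haarVV F)
    have h1 := Measure.addHaarMeasure_unique ((haarVV F).map g.symm) (W0Compacts F)
    have h2 : (haarVV F).map g.symm (W0Compacts F : Set (VV F)) = 1 := by
      erw [Measure.map_apply g.symm.continuous.measurable (s := (W F 0 : Set (VV F)))
        isOpen_W_zero.measurableSet, ← hg]
      congr 1
      exact (g.toEquiv.image_eq_preimage_symm _).symm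
    rw [h1, h2, one_smul]
    rfl
  exact MeasurePreserving.symm g.symm.toHomeomorph.toMeasurableEquiv hsymm

theorem mem_Qbar_zero_iff {g : GLL F} :
    g ∈ Qbar F 0 0 ↔ (W F 0).map (g.1 : VV F →ₗ[F] VV F) = W F 0 := by
  refine ⟨fun h => h.1, fun h => ⟨h, h, fun v hv => (W F 0).sub_mem ?_ hv⟩⟩
  exact h.le (Submodule.mem_map_of_mem hv)

/-- Each double coset of the stabilizer of `W_0` is invariant under inversion. -/
theorem exists_inv_eq_mul_mul (g : GLL F) :
    ∃ k ∈ Qbar F 0 0, ∃ l ∈ Qbar F 0 0, g⁻¹ = k * g * l := by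
  have hc : IsCompact (W F 0 : Set (VV F)) := (W0Compacts F).isCompact
  obtain ⟨h, hAB, hBA⟩ := exists_swap_of_measure_eq (haarVV F) (A := W F 0)
    (B := (W F 0).map (g.1 : VV F →ₗ[F] VV F)) hc (hc.image g.1.continuous) isOpen_W_zero
    (g.1.toHomeomorph.isOpenMap _ isOpen_W_zero) (measure_map_eq g.2 _).symm
  have hh : h ∈ GLL F := mem_GLL_of_measure_map (by rw [hAB, measure_map_eq g.2, haarVV_W_zero])
  let s : GLL F := ⟨h, hh⟩
  have hcomp : ∀ a b : GLL F, ((a * b).1 : VV F →ₗ[F] VV F) =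
      (a.1 : VV F →ₗ[F] VV F) ∘ₗ (b.1 : VV F →ₗ[F] VV F) := fun _ _ => rfl
  have hl : s * g ∈ Qbar F 0 0 := by
    rw [mem_Qbar_zero_iff, hcomp, Submodule.map_comp]
    exact hBA
  have hk : g⁻¹ * s ∈ Qbar F 0 0 := by
    rw [mem_Qbar_zero_iff, hcomp, Submodule.map_comp]
    change Submodule.map _ (Submodule.map (h : VV F →ₗ[F] VV F) (W F 0)) = _
    rw [hAB, ← Submodule.map_comp, ← hcomp, inv_mul_cancel]
    exact Submodule.map_id _
  exact ⟨(s * g)⁻¹, inv_mem hl, g⁻¹ * s, hk, by group⟩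

end Group

/-! ## The representation in `L²(𝕍)` -/

namespace UnitaryRep

variable {G : Type u} [Group G] [TopologicalSpace G]

/-- A homomorphism `U` to the group of linear isometries is a unitary representation if
`g ↦ U(g⁻¹) x` is continuous for all `x`. -/
def ofIsometry {H : Type v} [NormedAddCommGroup H] [InnerProductSpace ℂ H] [CompleteSpace H]
    (U : G →* (H ≃ₗᵢ[ℂ] H)) (hU : ∀ x, Continuous fun g => U g⁻¹ x) : UnitaryRep G H where
  toHom := Unitary.linearIsometryEquiv.symm.toMonoidHom.comp U
  continuous_apply x := by
    refine continuous_iff_continuousAt.2 fun g₀ => ?_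
    change Filter.Tendsto (fun g => U g x) (nhds g₀) (nhds (U g₀ x))
    rw [tendsto_iff_norm_sub_tendsto_zero]
    have hU' : ∀ g, RCLike.re (inner ℂ (U g x) (U g₀ x)) =
        RCLike.re (inner ℂ x (U g⁻¹ (U g₀ x))) := fun g => by
      have h1 : U g (U g⁻¹ (U g₀ x)) = U g₀ x :=
        congrArg (fun A : H ≃ₗᵢ[ℂ] H => A (U g₀ x)) ((map_mul_eq_one U (mul_inv_cancel g)))
      rw [← (U g).inner_map_map x (U g⁻¹ (U g₀ x)), h1]
    -- For isometries, strong continuity reduces to continuity of inner products, where `U g` can be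
    -- moved across as `U g⁻¹`. Thus continuity of inversion in `G` is not needed.
    have hsq : ∀ g, ‖U g x - U g₀ x‖ =
        √(2 * ‖x‖ ^ 2 - 2 * RCLike.re (inner ℂ x (U g⁻¹ (U g₀ x)))) := fun g => by
      rw [← hU', ← Real.sqrt_sq (norm_nonneg (U g x - U g₀ x)), norm_sub_sq (𝕜 := ℂ)]
      simp only [LinearIsometryEquiv.norm_map]
      congr 1
      ring
    have hcont : Continuous fun g => ‖U g x - U g₀ x‖ := by
      simp only [hsq]
      have h1 : Continuous fun g => RCLike.re (inner ℂ x (U g⁻¹ (U g₀ x))) :=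
        RCLike.continuous_re.comp (continuous_const.inner (hU (U g₀ x)))
      exact (continuous_const.sub (continuous_const.mul h1)).sqrt
    simpa using hcont.tendsto g₀

/-- The representation obtained by a unitary identification of Hilbert spaces. -/
def conj {H : Type u} [NormedAddCommGroup H] [InnerProductSpace ℂ H] [CompleteSpace H]
    {H' : Type v} [NormedAddCommGroup H'] [InnerProductSpace ℂ H'] [CompleteSpace H']
    (ρ : UnitaryRep G H) (e : H ≃ₗᵢ[ℂ] H') : UnitaryRep G H' where
  toHom :=
    { toFun g := Unitary.linearIsometryEquiv.symm
        ((e.symm.trans (Unitary.linearIsometryEquiv (ρ.toHom g))).trans e)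
      map_one' := by
        rw [← map_one Unitary.linearIsometryEquiv.symm, map_one, map_one]
        congr 1
        ext x
        exact e.apply_symm_apply x
      map_mul' g h := by
        rw [← map_mul Unitary.linearIsometryEquiv.symm, map_mul, map_mul]
        congr 1
        ext x
        simp }
  continuous_apply x := e.continuous.comp (ρ.continuous_apply (e.symm x))

theorem conj_op_apply {H : Type u} [NormedAddCommGroup H] [InnerProductSpace ℂ H]
    [CompleteSpace H] {H' : Type v} [NormedAddCommGroup H'] [InnerProductSpace ℂ H']
    [CompleteSpace H'] (ρ : UnitaryRep G H) (e : H ≃ₗᵢ[ℂ] H') (g : G) (x : H) :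
    (ρ.conj e).op g (e x) = e (ρ.op g x) :=
  congrArg (fun y => e (ρ.op g y)) (e.symm_apply_apply x)

end UnitaryRep

/-- Each separable Hilbert space is isometric to one in an arbitrary universe. -/
theorem exists_linearIsometryEquiv_lp (H : Type u) [NormedAddCommGroup H] [InnerProductSpace ℂ H]
    [CompleteSpace H] [SecondCountableTopology H] :
    ∃ ι : Type v, Nonempty (H ≃ₗᵢ[ℂ] lp (fun _ : ι => ℂ) 2) := by
  obtain ⟨w, b, hb⟩ := exists_hilbertBasis ℂ H
  -- Distinct orthonormal vectors are at distance `√2 ≥ 1`; separability then makes the basis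
  -- countable, so it can be reindexed by a lifted subset of `ℕ` in any universe.
  have hdisc : DiscreteTopology w := by
    refine DiscreteTopology.of_forall_le_dist one_pos fun x y hxy => ?_
    have ho : inner ℂ (x : H) (y : H) = 0 := by
      have := b.orthonormal.2 hxy
      rwa [hb] at this
    have h1 : ∀ z : w, ‖(z : H)‖ = 1 := fun z => by
      have := b.orthonormal.1 z
      rwa [hb] at this
    have h2 := norm_sub_sq (𝕜 := ℂ) (x : H) (y : H)
    rw [ho, h1, h1, map_zero] at h2
    change 1 ≤ dist (x : H) y
    rw [dist_eq_norm]
    nlinarith [norm_nonneg ((x : H) - y)]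
  have hcount : Countable w := TopologicalSpace.separableSpace_iff_countable.1 inferInstance
  obtain ⟨f, hf⟩ := exists_injective_nat w
  let e : w ≃ ULift.{v} (Set.range f) := (Equiv.ofInjective f hf).trans Equiv.ulift.symm
  let b' : HilbertBasis (ULift.{v} (Set.range f)) ℂ H :=
    HilbertBasis.mk (v := b ∘ e.symm)
      (b.orthonormal.comp _ e.symm.injective)
      (by rw [e.symm.surjective.range_comp, b.dense_span])
  exact ⟨_, ⟨b'.repr⟩⟩

section RegularRep

variable (F : Type u) [Field F] [Finite F]

theorem measurePreserving_of_mem_GLL (g : GLL F) :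
    MeasurePreserving (fun x => g.1 x) (haarVV F) (haarVV F) := g.2

/-- The action `f ↦ f ∘ g⁻¹` of `GLL` on `L²(𝕍)`. -/
def translation : GLL F →* (Lp ℂ 2 (haarVV F) ≃ₗᵢ[ℂ] Lp ℂ 2 (haarVV F)) where
  toFun g :=
    { Lp.compMeasurePreservingₗᵢ ℂ (fun x => (g⁻¹).1 x) (measurePreserving_of_mem_GLL F g⁻¹) with
      invFun := Lp.compMeasurePreserving (fun x => g.1 x) (measurePreserving_of_mem_GLL F g)
      left_inv := fun f => by
        refine (Lp.compMeasurePreserving_comp_apply f (measurePreserving_of_mem_GLL F g⁻¹)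
          (measurePreserving_of_mem_GLL F g)).symm.trans ?_
        convert! Lp.compMeasurePreserving_id_apply f
        exact funext fun x => g.1.symm_apply_apply x
      right_inv := fun f => by
        refine (Lp.compMeasurePreserving_comp_apply f (measurePreserving_of_mem_GLL F g)
          (measurePreserving_of_mem_GLL F g⁻¹)).symm.trans ?_
        convert! Lp.compMeasurePreserving_id_apply f
        exact funext fun x => g.1.apply_symm_apply x }
  map_one' := LinearIsometryEquiv.ext fun f => Lp.compMeasurePreserving_id_apply f
  map_mul' g h := LinearIsometryEquiv.ext fun f =>
    Lp.compMeasurePreserving_comp_apply f (measurePreserving_of_mem_GLL F h⁻¹)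
      (measurePreserving_of_mem_GLL F g⁻¹)

theorem translation_inv_apply (g : GLL F) (f : Lp ℂ 2 (haarVV F)) :
    translation F g⁻¹ f =
      Lp.compMeasurePreserving (fun x => g.1 x) (measurePreserving_of_mem_GLL F g) f :=
  rfl

/-- The unitary representation of `GLL` in `L²(𝕍)`. -/
def regularRep : UnitaryRep (GLL F) (Lp ℂ 2 (haarVV F)) :=
  UnitaryRep.ofIsometry (translation F) fun f => by
    simp only [translation_inv_apply]
    -- Composition with `g` depends continuously on `g` in the compact-open topology, which is the
    -- topology induced on `GLL F`.
    exact (continuous_const (y := f)).compMeasurePreservingLp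
      (g := fun g : GLL F => (⟨fun x => g.1 x, g.1.continuous⟩ : C(VV F, VV F)))
      continuous_induced_dom (measurePreserving_of_mem_GLL F) ENNReal.ofNat_ne_top

/-- The indicator function of `W_0`. -/
def indicatorW : Lp ℂ 2 (haarVV F) :=
  indicatorConstLp 2 (isOpen_W_zero (F := F)).measurableSet
    (by rw [haarVV_W_zero]; exact ENNReal.one_ne_top) 1

theorem indicatorW_ne_zero : indicatorW F ≠ 0 := by
  rw [← norm_ne_zero_iff, indicatorW, norm_indicatorConstLp two_ne_zero ENNReal.ofNat_ne_top,
    measureReal_def, haarVV_W_zero]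
  simp

theorem indicatorW_mem_fixedVectors :
    indicatorW F ∈ (regularRep F).fixedVectors (Qbar F 0 0) := by
  intro g hg
  have hpre : (fun x => (g⁻¹).1 x) ⁻¹' (W F 0 : Set (VV F)) = W F 0 := by
    have h1 := mem_Qbar_zero_iff.1 hg
    conv_rhs => rw [← h1]
    exact (g.1.toEquiv.image_eq_preimage_symm _).symm
  change Lp.compMeasurePreserving (fun x => (g⁻¹).1 x) (measurePreserving_of_mem_GLL F g⁻¹)
    (indicatorW F) = indicatorW F
  rw [indicatorW, Lp.indicatorConstLp_compMeasurePreserving]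
  congr 1

/-- `L²(𝕍)` lives in the universe of `F`; transporting it to an `ℓ²` space puts the representation
in the universe over which `IsSpherical` quantifies. -/
theorem exists_unitaryRep_fixedVectors_ne_bot :
    ∃ (H : Type v) (_ : NormedAddCommGroup H) (_ : InnerProductSpace ℂ H) (_ : CompleteSpace H)
      (_ : TopologicalSpace.SeparableSpace H) (ρ : UnitaryRep (GLL F) H),
      ρ.fixedVectors (Qbar F 0 0) ≠ ⊥ := by
  have : Fact ((2 : ENNReal) ≠ ⊤) := ⟨ENNReal.ofNat_ne_top⟩
  obtain ⟨ι, ⟨e⟩⟩ := exists_linearIsometryEquiv_lp.{u, v} (Lp ℂ 2 (haarVV F))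
  refine ⟨lp (fun _ : ι => ℂ) 2, inferInstance, inferInstance, inferInstance,
    e.surjective.denseRange.separableSpace e.continuous, (regularRep F).conj e, ?_⟩
  rw [Submodule.ne_bot_iff]
  refine ⟨e (indicatorW F), fun g hg => ?_, ?_⟩
  · rw [UnitaryRep.conj_op_apply, indicatorW_mem_fixedVectors F g hg]
  · rw [Ne, e.map_eq_zero_iff]
    exact indicatorW_ne_zero F

end RegularRep

end NeretinGL

end

theorem mainTheorem10 (F : Type u) [Field F] [Finite F] :
    NeretinGL.IsSpherical.{u, v} (NeretinGL.Qbar F 0 0) := by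
  exact ⟨fun H _ _ _ _ ρ hρ => ρ.rank_fixedVectors_le_one NeretinGL.exists_inv_eq_mul_mul hρ,
    NeretinGL.exists_unitaryRep_fixedVectors_ne_bot F⟩
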